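/- Let $\alpha>0$ and let $\mathbb{T}_\alpha=\mathbb{R}^2/(\alpha^{-1}\mathbb{Z}\times\alpha\mathbb{Z})$ be the rectangular torus of area $1$. For $(k,l)\in\mathbb{Z}^2$ put $e_{k,l}(x,y)=e^{2\pi i(\alpha k x+\alpha^{-1} l y)}$ and $\lambda_{k,l}=4\pi^2(\alpha^2k^2+\alpha^{-2}l^2)$; these are the eigenfunctions and eigenvalues of the (non-negative) Laplace–Beltrami operator on $\mathbb{T}_\alpha$. Let $$p_\alpha(z,w;t)=\sum_{(k,l)\in\mathbb{Z}^2}e^{-\lambda_{k,l}\,t/(4\pi)}\,e_{k,l}(z)\,\overline{e_{k,l}(w)},\qquad z,w\in\mathbb{T}_\alpha,\ t>0,$$ be the heat kernel of $\mathbb{T}_\alpha$, with time scaled by $t\mapsto t/(4\pi)$. For $0<q<1$ let $\theta_2(q)=\sum_{n\in\mathbb{Z}}q^{(n+1/2)^2}$ and $\theta_3(q)=\sum_{n\in\mathbb{Z}}q^{n^2}$, let $k(q)=\theta_2(q)^2/\theta_3(q)^2$ be the elliptic modulus and $k'(q)=\sqrt{1-k(q)^2}$ the complementary elliptic modulus.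 Let ${}_2F_1$ be Gauss' hypergeometric function, and write $k=k(e^{-\pi\alpha^2})$ and $k'=k'(e^{-\pi\alpha^2})$. Then, for every $w\in\mathbb{T}_\alpha$, the temperature $z\mapsto p_\alpha(z,w;1)$ at time $1$ attains its minimum and its maximum on $\mathbb{T}_\alpha$, and these are given by $$\min_{z\in\mathbb{T}_\alpha}p_\alpha(z,w;1)=\sqrt{k\,k'\;{}_2F_1\!\left(\tfrac12,\tfrac12;1;k^2\right){}_2F_1\!\left(\tfrac12,\tfrac12;1;k'^2\right)},$$ $$\max_{z\in\mathbb{T}_\alpha}p_\alpha(z,w;1)=\sqrt{{}_2F_1\!\left(\tfrac12,\tfrac12;1;k^2\right){}_2F_1\!\left(\tfrac12,\tfrac12;1;k'^2\right)}.$$ Moreover, $k'(e^{-\pi\alpha^2})=k(e^{-\pi\alpha^{-2}})$. -/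

import Mathlib

open Real
open scoped ComplexConjugate

noncomputable section

namespace RectTorus

/-- The rectangular torus `ℝ² / (α⁻¹ℤ × αℤ)`, as the product of the circles
`ℝ / α⁻¹ℤ` and `ℝ / αℤ`. For `α > 0` its area is `1`. -/
abbrev Torus (α : ℝ) : Type := AddCircle α⁻¹ × AddCircle α

/-- The eigenvalue `4π²(α²k² + α⁻²l²)` of the non-negative Laplace-Beltrami operator,
with `κ = (k, l)`. -/
def eigenvalue (α : ℝ) (κ : ℤ × ℤ) : ℝ :=
  4 * π ^ 2 * (α ^ 2 * (κ.1 : ℝ) ^ 2 + α⁻¹ ^ 2 * (κ.2 : ℝ) ^ 2)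

/-- The eigenfunction `(x, y) ↦ exp (2πi (α k x + α⁻¹ l y))` on the torus, with `κ = (k, l)`;
see `eigenfunction_coe`. -/
def eigenfunction (α : ℝ) (κ : ℤ × ℤ) (z : Torus α) : ℂ :=
  fourier κ.1 z.1 * fourier κ.2 z.2

/-- The term with index `κ` of the eigenfunction expansion of the heat kernel. -/
def heatTerm (α s : ℝ) (z w : Torus α) (κ : ℤ × ℤ) : ℂ :=
  (rexp (-eigenvalue α κ * s) : ℂ) * (eigenfunction α κ z * conj (eigenfunction α κ w))

/-- The heat kernel of the torus at the (unscaled) time `s`, that is, the integral kernel of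
`exp (-s Δ)`, given by its eigenfunction expansion. The series converges absolutely and its sum is
real (see `hasSum_heatTerm`), so that taking the real part loses nothing. -/
def heatKernel (α s : ℝ) (z w : Torus α) : ℝ :=
  (∑' κ : ℤ × ℤ, heatTerm α s z w κ).re

/-- The temperature at the point `z` at time `t` when the heat source sits at `w`. Time is scaled by
`t ↦ t / (4π)`, so that the summands are
`exp (-π t (α²k² + α⁻²l²)) * exp (2πi (α k (x₁ - x₂) + α⁻¹ l (y₁ - y₂)))`. -/
def temperature (α t : ℝ) (z w : Torus α) : ℝ :=
  heatKernel α (t / (4 * π)) z w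

/-- The theta-null `θ₂(q) = ∑ q^((k + 1/2)²)`, summed over the integers, for `0 < q < 1`. -/
def thetaNull₂ (q : ℝ) : ℝ := ∑' k : ℤ, q ^ (((k : ℝ) + 1 / 2) ^ 2)

/-- The theta-null `θ₃(q) = ∑ q^(k²)`, summed over the integers, for `0 < q < 1`. -/
def thetaNull₃ (q : ℝ) : ℝ := ∑' k : ℤ, q ^ ((k : ℝ) ^ 2)

/-- The elliptic modulus `k(q) = θ₂(q)² / θ₃(q)²`. -/
def ellipticModulus (q : ℝ) : ℝ := thetaNull₂ q ^ 2 / thetaNull₃ q ^ 2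

/-- The complementary elliptic modulus `k'(q) ≥ 0`, determined by `k(q)² + k'(q)² = 1`. -/
def complementaryModulus (q : ℝ) : ℝ := √(1 - ellipticModulus q ^ 2)

/-! The remaining facts check the definitions. -/

theorem eigenfunction_coe (α : ℝ) (κ : ℤ × ℤ) (x y : ℝ) :
    eigenfunction α κ ((x : AddCircle α⁻¹), (y : AddCircle α)) =
      Complex.exp (2 * π * Complex.I * (α * κ.1 * x + α⁻¹ * κ.2 * y)) := by
  rw [eigenfunction, fourier_coe_apply, fourier_coe_apply, ← Complex.exp_add]
  congr 1
  push_cast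
  rw [div_inv_eq_mul, div_eq_mul_inv]
  ring

theorem hasDerivAt_exp_affine (a b : ℂ) (x : ℝ) (c : ℂ) :
    HasDerivAt (fun u : ℝ => c * Complex.exp (a * u + b)) (c * a * Complex.exp (a * x + b)) x := by
  have h : HasDerivAt (fun u : ℝ => a * (u : ℂ) + b) (a * 1) x :=
    ((Complex.ofRealCLM.hasDerivAt (x := x)).const_mul a).add_const b
  simpa [mul_assoc, mul_comm, mul_left_comm] using h.cexp.const_mul c

theorem deriv_deriv_exp_affine (a b : ℂ) (x : ℝ) :
    deriv (deriv fun u : ℝ => Complex.exp (a * u + b)) x = a ^ 2 * Complex.exp (a * x + b) := by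
  have h : (deriv fun u : ℝ => Complex.exp (a * u + b)) =
      fun u : ℝ => a * Complex.exp (a * u + b) := by
    funext u
    simpa using (hasDerivAt_exp_affine a b u 1).deriv
  rw [h, (hasDerivAt_exp_affine a b x a).deriv]
  ring

/-- The eigenfunctions satisfy `-(∂²/∂x² + ∂²/∂y²) e = λ e`. -/
theorem laplacian_eigenfunction {α : ℝ} (κ : ℤ × ℤ) (x y : ℝ) :
    -(deriv (deriv fun u : ℝ => eigenfunction α κ ((u : AddCircle α⁻¹), (y : AddCircle α))) x +
      deriv (deriv fun v : ℝ => eigenfunction α κ ((x : AddCircle α⁻¹), (v : AddCircle α))) y) =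
    (eigenvalue α κ : ℂ) * eigenfunction α κ ((x : AddCircle α⁻¹), (y : AddCircle α)) := by
  simp only [eigenfunction_coe]
  have h1 : (fun u : ℝ => Complex.exp (2 * π * Complex.I * (α * κ.1 * u + α⁻¹ * κ.2 * y))) =
      fun u : ℝ => Complex.exp ((2 * π * Complex.I * (α * κ.1)) * u +
        2 * π * Complex.I * (α⁻¹ * κ.2 * y)) := by
    funext u; ring_nf
  have h2 : (fun v : ℝ => Complex.exp (2 * π * Complex.I * (α * κ.1 * x + α⁻¹ * κ.2 * v))) =
      fun v : ℝ => Complex.exp ((2 * π * Complex.I * (α⁻¹ * κ.2)) * v +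
        2 * π * Complex.I * (α * κ.1 * x)) := by
    funext u; ring_nf
  rw [h1, h2, deriv_deriv_exp_affine, deriv_deriv_exp_affine]
  have e1 : (2 * π * Complex.I * (α * κ.1)) * x + 2 * π * Complex.I * (α⁻¹ * κ.2 * y) =
      2 * π * Complex.I * (α * κ.1 * x + α⁻¹ * κ.2 * y) := by ring
  have e2 : (2 * π * Complex.I * (α⁻¹ * κ.2)) * y + 2 * π * Complex.I * (α * κ.1 * x) =
      2 * π * Complex.I * (α * κ.1 * x + α⁻¹ * κ.2 * y) := by ring
  rw [e1, e2, eigenvalue]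
  push_cast
  simp only [mul_pow, Complex.I_sq]
  ring

theorem norm_eigenfunction (α : ℝ) (κ : ℤ × ℤ) (z : Torus α) : ‖eigenfunction α κ z‖ = 1 := by
  rw [eigenfunction, norm_mul, fourier_apply, fourier_apply, Circle.norm_coe, Circle.norm_coe,
    one_mul]

theorem eigenfunction_neg (α : ℝ) (κ : ℤ × ℤ) (z : Torus α) :
    eigenfunction α (-κ) z = conj (eigenfunction α κ z) := by
  simp only [eigenfunction, Prod.fst_neg, Prod.snd_neg, map_mul, fourier_neg]

theorem summable_gaussian {T : ℝ} (hT : 0 < T) :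
    Summable fun n : ℤ => rexp (-π * (T * (n : ℝ) ^ 2)) := by
  simpa using summable_pow_mul_jacobiTheta₂_term_bound 0 hT 0

theorem summable_heatTerm {α s : ℝ} (hα : 0 < α) (hs : 0 < s) (z w : Torus α) :
    Summable (heatTerm α s z w) := by
  have h1 := summable_gaussian (T := 4 * π * α ^ 2 * s) (by positivity)
  have h2 := summable_gaussian (T := 4 * π * α⁻¹ ^ 2 * s) (by positivity)
  have h := h1.mul_of_nonneg h2 (fun _ => (exp_pos _).le) (fun _ => (exp_pos _).le)
  refine Summable.of_norm_bounded h fun κ => le_of_eq ?_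
  rw [heatTerm, norm_mul, norm_mul, RCLike.norm_conj, norm_eigenfunction, norm_eigenfunction,
    Complex.norm_real, norm_of_nonneg (exp_pos _).le, ← Real.exp_add, eigenvalue]
  ring_nf

/-- The eigenfunction expansion converges absolutely to the real number `heatKernel α s z w`. -/
theorem hasSum_heatTerm {α s : ℝ} (hα : 0 < α) (hs : 0 < s) (z w : Torus α) :
    HasSum (heatTerm α s z w) (heatKernel α s z w : ℂ) := by
  have h := (summable_heatTerm hα hs z w).hasSum
  have hc : conj (∑' κ, heatTerm α s z w κ) = ∑' κ, heatTerm α s z w κ := by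
    rw [Complex.conj_tsum, ← (Equiv.neg (ℤ × ℤ)).tsum_eq]
    refine tsum_congr fun κ => ?_
    have he : eigenvalue α (-κ) = eigenvalue α κ := by simp [eigenvalue]
    simp only [Equiv.neg_apply, heatTerm, he, eigenfunction_neg, map_mul, Complex.conj_ofReal,
      Complex.conj_conj]
  rw [heatKernel, Complex.conj_eq_iff_re.mp hc]
  exact h

end RectTorus

end

/-!
The temperature factors into a product over the two circles, `θ(α², u) θ(α⁻², v)` with `θ(s, u) =
∑ exp (-π s k²) cos (2π k u)` (`temperature_one_coe`). So the extrema are the products of the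
extrema of the factors. The maximum of `θ(s, ·)` is plainly at `u = 0`. The minimum is at `u = 1 /
2` (`circleTheta_half_le`), because the Jacobi triple product writes `θ(s, u)` as a positive
constant times the product of the factors `1 + 2 p^(2n-1) cos (2π u) + p^(4n-2)` with
`p = exp (-π s)`, each of which is nonnegative and smallest where the cosine is `-1`. Only a finite form of the triple product is
needed, with a passage to the limit in the coefficients.

Thus the maximum is `θ₃(q) θ₃(q')` and the minimum is `θ₄(q) θ₄(q')`, where `q = exp (-π α²)` and
`q' = exp (-π α⁻²)`. By Poisson summation `θ₄(q) θ₄(q') = θ₂(q) θ₂(q')`, and with Jacobi's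
identity `θ₃⁴ = θ₂⁴ + θ₄⁴` it also gives `k'(q) = k(q')` (`complementaryModulus_exp`).

The link with the hypergeometric function is `₂F₁(1/2, 1/2; 1; k(q)²) = θ₃(q)²`
(`ordinaryHypergeometric_ellipticModulus_sq`). When `q` is replaced by `q²`, the right side
changes by the duplication formula `θ₃(q)² = θ₃(q²)² + θ₂(q²)²`, and the left side changes by the
same factor `1 + k(q²)` by Landen's transformation (`ordinaryHypergeometric_landen`). Iteration
drives `q` to `0`, where both sides tend to `1`. Landen's transformation comes from computing the
mean of `|1 + x e^{2iψ}|⁻¹` over the circle in two ways: by Parseval's identity, and by expanding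
`((1 + x)² - 4 x sin² ψ) ^ (-1/2)` in powers of `sin² ψ`. -/

/-! ### The hypergeometric function and Landen's transformation -/

/-- The coefficient `(1/2)ₙ / n! = (1 · 3 ⋯ (2n - 1)) / (2 · 4 ⋯ 2n)` of `zⁿ` in the binomial
series of `(1 - z) ^ (-1/2)`. -/
noncomputable def wallisCoeff (n : ℕ) : ℝ := ∏ i ∈ Finset.range n, (2 * (i : ℝ) + 1) / (2 * i + 2)

theorem wallisCoeff_succ (n : ℕ) :
    wallisCoeff (n + 1) = wallisCoeff n * ((2 * (n : ℝ) + 1) / (2 * n + 2)) :=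
  Finset.prod_range_succ _ _

theorem wallisCoeff_nonneg (n : ℕ) : 0 ≤ wallisCoeff n :=
  Finset.prod_nonneg fun i _ => by positivity

theorem wallisCoeff_le_one (n : ℕ) : wallisCoeff n ≤ 1 :=
  Finset.prod_le_one (fun i _ => by positivity) fun i _ => by
    rw [div_le_one (by positivity)]
    linarith

theorem ascPochhammer_half_eval {K : Type*} [RCLike K] (n : ℕ) :
    (ascPochhammer K n).eval (1 / 2) = n.factorial * ((wallisCoeff n : ℝ) : K) := by
  induction n with
  | zero => simp [wallisCoeff]
  | succ n ih =>
    have h : (n : K) + 1 ≠ 0 := by exact_mod_cast n.succ_ne_zero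
    rw [ascPochhammer_succ_eval, ih, wallisCoeff_succ, Nat.factorial_succ]
    push_cast
    rw [show (2 * (n : K) + 2) = 2 * (n + 1) by ring]
    field_simp
    ring

theorem ordinaryHypergeometric_half_half_one (x : ℝ) :
    ₂F₁ (1 / 2 : ℝ) (1 / 2 : ℝ) (1 : ℝ) x = ∑' n, wallisCoeff n ^ 2 * x ^ n := by
  rw [ordinaryHypergeometric_eq_tsum]
  refine tsum_congr fun n => ?_
  have h : (n.factorial : ℝ) ≠ 0 := by positivity
  rw [ascPochhammer_half_eval, ascPochhammer_eval_one, smul_eq_mul, RCLike.ofReal_real_eq_id, id]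
  field_simp

theorem hasSum_wallisCoeff {z : ℂ} (hz : ‖z‖ < 1) :
    HasSum (fun n => (wallisCoeff n : ℂ) * z ^ n) (1 / (1 - z) ^ (1 / 2 : ℂ)) := by
  have h := (Complex.one_div_one_sub_cpow_hasFPowerSeriesOnBall_zero (1 / 2)).hasSum (y := z)
    (by simpa [enorm_eq_nnnorm, ← NNReal.coe_lt_one] using hz)
  rw [zero_add] at h
  refine h.congr_fun fun n => ?_
  have hc : Ring.choose ((1 / 2 : ℂ) + n - 1) n = wallisCoeff n := by
    have h1 := Ring.factorial_nsmul_multichoose_eq_ascPochhammer (1 / 2 : ℂ) n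
    rw [Polynomial.ascPochhammer_smeval_eq_eval, ascPochhammer_half_eval, nsmul_eq_mul] at h1
    have h4 : (n.factorial : ℂ) ≠ 0 := by exact_mod_cast n.factorial_ne_zero
    rw [Ring.choose, show (1 / 2 : ℂ) + n - 1 - n + 1 = 1 / 2 by ring]
    exact mul_left_cancel₀ h4 h1
  rw [FormalMultilinearSeries.ofScalars_apply_eq, hc, smul_eq_mul]

theorem sq_norm_one_div_one_sub_cpow_half (z : ℂ) :
    ‖1 / (1 - z) ^ (1 / 2 : ℂ)‖ ^ 2 = 1 / ‖1 - z‖ := by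
  rw [← norm_pow, div_pow, one_pow, one_div (2 : ℂ), Complex.cpow_ofNat_inv_pow, norm_div,
    norm_one]

theorem hasSum_wallisCoeff_real {u : ℝ} (hu : 0 ≤ u) (hu1 : u < 1) :
    HasSum (fun n => wallisCoeff n * u ^ n) (1 / √(1 - u)) := by
  have h := hasSum_wallisCoeff (z := u) (by rwa [Complex.norm_real, norm_of_nonneg hu])
  rw [← Complex.hasSum_ofReal]
  push_cast
  convert h using 1
  rw [sqrt_eq_rpow, Complex.ofReal_cpow (by linarith)]
  push_cast
  rfl

/-- `|1 + x e^{2iψ}|² = (1 + x)² - 4x sin²ψ`. -/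
theorem sq_norm_one_add_mul_cexp (x ψ : ℝ) :
    ‖1 + x * Complex.exp (2 * ψ * Complex.I)‖ ^ 2 = (1 + x) ^ 2 - 4 * x * sin ψ ^ 2 := by
  rw [← Complex.normSq_eq_norm_sq, show (2 * ψ * Complex.I : ℂ) = ((2 * ψ : ℝ) : ℂ) * Complex.I by
    push_cast; ring, Complex.exp_mul_I, ← Complex.ofReal_cos, ← Complex.ofReal_sin]
  simp only [Complex.normSq_apply, Complex.add_re, Complex.one_re,
    Complex.add_im, Complex.one_im, Complex.ofReal_re, Complex.ofReal_im,
    Complex.mul_re, Complex.mul_im, Complex.I_re, Complex.I_im]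
  have h1 := sin_sq_add_cos_sq (2 * ψ)
  have h2 := cos_two_mul ψ
  have h3 := sin_sq_add_cos_sq ψ
  linear_combination x ^ 2 * h1 + 2 * x * h2 + 4 * x * h3

open intervalIntegral in
/-- The binomial expansion in powers of `sin² ψ`, integrated term by term. -/
theorem integral_one_div_sqrt_one_sub_mul_sin_sq {m : ℝ} (hm : 0 ≤ m) (hm1 : m < 1) :
    ∫ ψ in (0 : ℝ)..π, 1 / √(1 - m * sin ψ ^ 2) = π * ₂F₁ (1 / 2 : ℝ) (1 / 2 : ℝ) (1 : ℝ) m := by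
  have key : HasSum
      (fun n : ℕ => ∫ ψ in (0 : ℝ)..π, wallisCoeff n * (m * sin ψ ^ 2) ^ n)
      (∫ ψ in (0 : ℝ)..π, 1 / √(1 - m * sin ψ ^ 2)) := by
    refine hasSum_integral_of_dominated_convergence (fun n _ => m ^ n) (fun n => ?_) (fun n => ?_)
      ?_ ?_ ?_
    · exact (by fun_prop : Continuous fun ψ : ℝ =>
        wallisCoeff n * (m * sin ψ ^ 2) ^ n).aestronglyMeasurable
    · refine Filter.Eventually.of_forall fun ψ _ => ?_
      rw [Real.norm_of_nonneg (mul_nonneg (wallisCoeff_nonneg n) (by positivity))]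
      calc wallisCoeff n * (m * sin ψ ^ 2) ^ n ≤ 1 * (m * 1) ^ n := by
            gcongr
            · exact wallisCoeff_le_one n
            · exact sin_sq_le_one ψ
        _ = m ^ n := by simp
    · exact Filter.Eventually.of_forall fun ψ _ => summable_geometric_of_lt_one hm hm1
    · simp
    · refine Filter.Eventually.of_forall fun ψ _ => hasSum_wallisCoeff_real (by positivity) ?_
      nlinarith [sin_sq_le_one ψ, sq_nonneg (sin ψ)]
  rw [← key.tsum_eq, ordinaryHypergeometric_half_half_one, ← tsum_mul_left]
  refine tsum_congr fun n => ?_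
  simp only [mul_pow, ← pow_mul, integral_const_mul]
  rw [integral_sin_pow_even]
  change _ * (_ * (π * wallisCoeff n)) = _
  ring

theorem integral_cexp_two_mul_int (k : ℤ) :
    ∫ ψ in (0 : ℝ)..π, Complex.exp (2 * k * ψ * Complex.I) = if k = 0 then (π : ℂ) else 0 := by
  split_ifs with h
  · simp [h]
  · have hc : (2 * k * Complex.I : ℂ) ≠ 0 := by simp [h]
    have := integral_exp_mul_complex (a := 0) (b := π) hc
    rw [show (fun ψ : ℝ => Complex.exp (2 * k * ψ * Complex.I)) =
      fun ψ : ℝ => Complex.exp (2 * k * Complex.I * ψ) by funext; ring_nf, this]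
    rw [show (2 * k * Complex.I * π : ℂ) = k * (2 * π * Complex.I) by ring,
      Complex.exp_int_mul_two_pi_mul_I]
    simp

theorem hasSum_mul_conj_prod {ι : Type*} {f : ι → ℂ} {s : ℂ} (hf : Summable fun i => ‖f i‖)
    (h : HasSum f s) : HasSum (fun p : ι × ι => f p.1 * conj (f p.2)) ((‖s‖ ^ 2 : ℝ) : ℂ) := by
  have hg : Summable fun i => ‖conj (f i)‖ := by simpa only [RCLike.norm_conj] using hf
  have hs := summable_mul_of_summable_norm hf hg
  have hc : HasSum (fun i => conj (f i)) (conj s) := Complex.hasSum_conj'.mpr h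
  have hm := h.mul hc hs
  rwa [Complex.mul_conj, Complex.normSq_eq_norm_sq] at hm

open intervalIntegral in
/-- Parseval's identity on the circle for `(1 + x e^{2iψ}) ^ (-1/2)`. -/
theorem integral_one_div_norm_one_add_mul_cexp {x : ℝ} (hx : 0 ≤ x) (hx1 : x < 1) :
    ∫ ψ in (0 : ℝ)..π, 1 / ‖1 + x * Complex.exp (2 * ψ * Complex.I)‖ =
      π * ₂F₁ (1 / 2 : ℝ) (1 / 2 : ℝ) (1 : ℝ) (x ^ 2) := by
  have hz (ψ : ℝ) : ‖-(x * Complex.exp (2 * ψ * Complex.I))‖ = x := by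
    rw [norm_neg, norm_mul, Complex.norm_real, norm_of_nonneg hx,
      show (2 * ψ * Complex.I : ℂ) = ((2 * ψ : ℝ) : ℂ) * Complex.I by push_cast; ring,
      Complex.norm_exp_ofReal_mul_I, mul_one]
  set z : ℝ → ℂ := fun ψ => -(x * Complex.exp (2 * ψ * Complex.I)) with hzdef
  have hzc : Continuous z := by fun_prop
  set F : ℕ × ℕ → ℝ → ℂ := fun p ψ =>
    (wallisCoeff p.1 * z ψ ^ p.1) * conj (wallisCoeff p.2 * z ψ ^ p.2) with hF
  have hgeo := summable_geometric_of_lt_one hx hx1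
  have hnorm (n : ℕ) (ψ : ℝ) : ‖(wallisCoeff n : ℂ) * z ψ ^ n‖ ≤ x ^ n := by
    rw [norm_mul, norm_pow, hz, Complex.norm_real, norm_of_nonneg (wallisCoeff_nonneg n)]
    exact mul_le_of_le_one_left (by positivity) (wallisCoeff_le_one n)
  have hsum (ψ : ℝ) : Summable fun n => ‖(wallisCoeff n : ℂ) * z ψ ^ n‖ :=
    Summable.of_nonneg_of_le (fun _ => norm_nonneg _) (fun n => hnorm n ψ) hgeo
  have key : HasSum (fun p => ∫ ψ in (0 : ℝ)..π, F p ψ)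
      (∫ ψ in (0 : ℝ)..π, ((1 / ‖1 + x * Complex.exp (2 * ψ * Complex.I)‖ : ℝ) : ℂ)) := by
    refine hasSum_integral_of_dominated_convergence (fun p _ => x ^ p.1 * x ^ p.2) (fun p => ?_)
      (fun p => ?_) ?_ ?_ ?_
    · refine Continuous.aestronglyMeasurable ?_
      simp only [hF]
      fun_prop
    · refine Filter.Eventually.of_forall fun ψ _ => ?_
      rw [hF, norm_mul, RCLike.norm_conj]
      exact mul_le_mul (hnorm _ _) (hnorm _ _) (norm_nonneg _) (by positivity)
    · exact Filter.Eventually.of_forall fun ψ _ =>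
        hgeo.mul_of_nonneg hgeo (fun _ => by positivity) (fun _ => by positivity)
    · simp
    · refine Filter.Eventually.of_forall fun ψ _ => ?_
      have h := hasSum_wallisCoeff (z := z ψ) (by rw [hz]; exact hx1)
      have hm := hasSum_mul_conj_prod (hsum ψ) h
      rw [sq_norm_one_div_one_sub_cpow_half, hzdef, sub_neg_eq_add] at hm
      exact hm
  have hint (p : ℕ × ℕ) : ∫ ψ in (0 : ℝ)..π, F p ψ =
      if p.1 = p.2 then ((π * (wallisCoeff p.1 ^ 2 * (x ^ 2) ^ p.1) : ℝ) : ℂ) else 0 := by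
    have h1 (ψ : ℝ) : F p ψ = (wallisCoeff p.1 * wallisCoeff p.2 * (-x) ^ p.1 * (-x) ^ p.2) *
        Complex.exp (2 * ((p.1 - p.2 : ℤ) : ℂ) * ψ * Complex.I) := by
      simp only [hF, hzdef, map_mul, map_pow, Complex.conj_ofReal, map_neg, ← Complex.exp_conj,
        Complex.conj_I, map_ofNat]
      have : Complex.exp (2 * ((p.1 - p.2 : ℤ) : ℂ) * ψ * Complex.I) =
          Complex.exp (2 * ψ * Complex.I) ^ p.1 * Complex.exp (2 * ψ * -Complex.I) ^ p.2 := by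
        rw [← Complex.exp_nat_mul, ← Complex.exp_nat_mul, ← Complex.exp_add]
        push_cast
        ring_nf
      rw [this, ← neg_mul, ← neg_mul, mul_pow, mul_pow]
      ring
    simp_rw [h1, integral_const_mul, integral_cexp_two_mul_int]
    by_cases hp : p.1 = p.2
    · simp only [hp, sub_self, if_true]
      push_cast
      rw [neg_pow, ← pow_mul, two_mul, pow_add]
      have : ((-1 : ℂ) ^ p.2) ^ 2 = 1 := by rw [← pow_mul, mul_comm, pow_mul]; simp
      linear_combination (wallisCoeff p.2 ^ 2 * (x : ℂ) ^ p.2 * (x : ℂ) ^ p.2 * π) * this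
    · have : ((p.1 : ℤ) - p.2) ≠ 0 := by omega
      simp [hp, this]
  simp_rw [hint] at key
  have hdiag : HasSum (fun n : ℕ => ((π * (wallisCoeff n ^ 2 * (x ^ 2) ^ n) : ℝ) : ℂ))
      (∫ ψ in (0 : ℝ)..π, ((1 / ‖1 + x * Complex.exp (2 * ψ * Complex.I)‖ : ℝ) : ℂ)) := by
    have hinj : Function.Injective fun n : ℕ => (n, n) := fun a b h => by simpa using h
    rw [← hinj.hasSum_iff] at key
    · simpa [Function.comp_def] using key
    · rintro ⟨a, b⟩ hab
      rw [if_neg]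
      exact fun h => hab ⟨a, Prod.ext rfl h⟩
  rw [intervalIntegral.integral_ofReal, Complex.hasSum_ofReal] at hdiag
  rw [← hdiag.tsum_eq, tsum_mul_left, ordinaryHypergeometric_half_half_one]

/-- **Landen's transformation** of the complete elliptic integral, in Gauss' form. -/
theorem ordinaryHypergeometric_landen {x : ℝ} (hx : 0 ≤ x) (hx1 : x < 1) :
    ₂F₁ (1 / 2 : ℝ) (1 / 2 : ℝ) (1 : ℝ) (4 * x / (1 + x) ^ 2) =
      (1 + x) * ₂F₁ (1 / 2 : ℝ) (1 / 2 : ℝ) (1 : ℝ) (x ^ 2) := by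
  have hm : 4 * x / (1 + x) ^ 2 < 1 := by
    rw [div_lt_one (by positivity)]
    nlinarith [sq_pos_of_pos (sub_pos.mpr hx1)]
  have h1 := integral_one_div_sqrt_one_sub_mul_sin_sq (m := 4 * x / (1 + x) ^ 2) (by positivity) hm
  have h2 := integral_one_div_norm_one_add_mul_cexp hx hx1
  have h3 : ∫ ψ in (0 : ℝ)..π, 1 / √(1 - 4 * x / (1 + x) ^ 2 * sin ψ ^ 2) =
      (1 + x) * ∫ ψ in (0 : ℝ)..π, 1 / ‖1 + x * Complex.exp (2 * ψ * Complex.I)‖ := by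
    rw [← intervalIntegral.integral_const_mul]
    congr 1
    funext ψ
    have h4 : 1 - 4 * x / (1 + x) ^ 2 * sin ψ ^ 2 =
        (‖1 + x * Complex.exp (2 * ψ * Complex.I)‖ / (1 + x)) ^ 2 := by
      rw [div_pow, sq_norm_one_add_mul_cexp]
      field_simp
    rw [h4, sqrt_sq (by positivity), one_div_div, mul_one_div]
  rw [h1, h2] at h3
  exact mul_left_cancel₀ pi_ne_zero (by linear_combination h3)

theorem tendsto_ordinaryHypergeometric_zero :
    Filter.Tendsto (₂F₁ (1 / 2 : ℝ) (1 / 2 : ℝ) (1 : ℝ)) (nhds (0 : ℝ)) (nhds 1) := by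
  have h := tendsto_tsum_of_dominated_convergence (𝓕 := nhds (0 : ℝ))
    (f := fun (x : ℝ) n => wallisCoeff n ^ 2 * x ^ n) (g := fun n => wallisCoeff n ^ 2 * 0 ^ n)
    (bound := fun n => (1 / 2 : ℝ) ^ n) (summable_geometric_of_lt_one (by norm_num) (by norm_num))
    (fun n => ((continuous_const.mul (continuous_pow n)).tendsto 0)) ?_
  · simp_rw [← ordinaryHypergeometric_half_half_one] at h
    rwa [ordinaryHypergeometric_zero] at h
  · filter_upwards [Metric.ball_mem_nhds (0 : ℝ) (by norm_num : (0 : ℝ) < 1 / 2)] with x hx n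
    rw [mem_ball_zero_iff] at hx
    rw [norm_mul, norm_pow, norm_pow, Real.norm_of_nonneg (wallisCoeff_nonneg n)]
    calc wallisCoeff n ^ 2 * ‖x‖ ^ n ≤ 1 * (1 / 2) ^ n := by
          gcongr
          exact pow_le_one₀ (wallisCoeff_nonneg n) (wallisCoeff_le_one n)
      _ = _ := one_mul _

/-! ### Theta-nulls and the elliptic modulus -/

/-- The theta function `∑ exp (-π s k²) cos (2π k x)`: the temperature at the point `x` of the
circle `ℝ / ℤ`, at a time proportional to `s`, of a heat source at `0`. Its values at `x = 0` and
`x = 1 / 2` are the theta-nulls `θ₃` and `θ₄` of the nome `exp (-π s)`. -/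
noncomputable def circleTheta (s x : ℝ) : ℝ :=
  ∑' k : ℤ, rexp (-π * s * (k : ℝ) ^ 2) * cos (2 * π * k * x)

/-- The theta-null `θ₂` as a function of the parameter `s` of the nome `exp (-π s)`. -/
noncomputable def shiftedTheta (s : ℝ) : ℝ := ∑' k : ℤ, rexp (-π * s * ((k : ℝ) + 1 / 2) ^ 2)

theorem circleTheta_zero (s : ℝ) : circleTheta s 0 = ∑' k : ℤ, rexp (-π * s * (k : ℝ) ^ 2) := by
  simp [circleTheta]

theorem cos_two_pi_mul_int_mul_half (k : ℤ) : cos (2 * π * k * (1 / 2)) = (-1) ^ k := by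
  rw [← cos_int_mul_pi]
  ring_nf

theorem circleTheta_half (s : ℝ) :
    circleTheta s (1 / 2) = ∑' k : ℤ, rexp (-π * s * (k : ℝ) ^ 2) * (-1) ^ k :=
  tsum_congr fun k => by rw [cos_two_pi_mul_int_mul_half]

theorem thetaNull₃_exp (s : ℝ) : RectTorus.thetaNull₃ (rexp (-π * s)) = circleTheta s 0 := by
  rw [circleTheta_zero]
  exact tsum_congr fun k => by rw [← exp_mul]

theorem thetaNull₂_exp (s : ℝ) : RectTorus.thetaNull₂ (rexp (-π * s)) = shiftedTheta s :=
  tsum_congr fun k => by rw [← exp_mul]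

theorem ellipticModulus_exp (s : ℝ) :
    RectTorus.ellipticModulus (rexp (-π * s)) = shiftedTheta s ^ 2 / circleTheta s 0 ^ 2 := by
  rw [RectTorus.ellipticModulus, thetaNull₂_exp, thetaNull₃_exp]

theorem summable_exp_neg_mul_int_sq {s : ℝ} (hs : 0 < s) :
    Summable fun k : ℤ => rexp (-π * s * (k : ℝ) ^ 2) := by
  simpa only [mul_assoc] using RectTorus.summable_gaussian hs

theorem summable_exp_neg_mul_int_sq_norm {s : ℝ} (hs : 0 < s) :
    Summable fun k : ℤ => ‖rexp (-π * s * (k : ℝ) ^ 2)‖ := by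
  simpa only [norm_of_nonneg (exp_pos _).le] using summable_exp_neg_mul_int_sq hs

theorem summable_exp_neg_mul_int_add_half_sq {s : ℝ} (hs : 0 < s) :
    Summable fun k : ℤ => rexp (-π * s * ((k : ℝ) + 1 / 2) ^ 2) := by
  refine Summable.of_nonneg_of_le (fun _ => (exp_pos _).le) (fun k => ?_)
    (by simpa using summable_pow_mul_jacobiTheta₂_term_bound (s / 2) hs 0)
  rw [exp_le_exp]
  have h : -(k : ℝ) ≤ |(k : ℝ)| := neg_le_abs _
  have h2 : 0 < π * s := by positivity
  nlinarith

theorem circleTheta_zero_pos {s : ℝ} (hs : 0 < s) : 0 < circleTheta s 0 := by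
  rw [circleTheta_zero]
  exact (summable_exp_neg_mul_int_sq hs).tsum_pos (fun _ => (exp_pos _).le) 0 (exp_pos _)

theorem shiftedTheta_pos {s : ℝ} (hs : 0 < s) : 0 < shiftedTheta s :=
  (summable_exp_neg_mul_int_add_half_sq hs).tsum_pos (fun _ => (exp_pos _).le) 0 (exp_pos _)

/-- The modular transformation `s ↦ 1 / s` of `θ₃`. -/
theorem circleTheta_zero_eq_inv {s : ℝ} (hs : 0 < s) :
    circleTheta s 0 = 1 / √s * circleTheta s⁻¹ 0 := by
  rw [circleTheta_zero, circleTheta_zero, tsum_exp_neg_mul_int_sq hs, sqrt_eq_rpow]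
  simp only [div_eq_mul_inv]

/-- The modular transformation `s ↦ 1 / s` exchanges `θ₄` and `θ₂`. -/
theorem circleTheta_half_eq_inv {s : ℝ} (hs : 0 < s) :
    circleTheta s (1 / 2) = 1 / √s * shiftedTheta s⁻¹ := by
  have h := Complex.tsum_exp_neg_quadratic (a := s) (by simpa using hs) (-Complex.I / 2)
  rw [circleTheta_half, shiftedTheta, sqrt_eq_rpow, ← Complex.ofReal_inj]
  rw [show ((1 / 2 : ℂ)) = ((1 / 2 : ℝ) : ℂ) by push_cast; rfl, ← Complex.ofReal_cpow hs.le] at h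
  push_cast
  convert h using 1
  · refine tsum_congr fun k => ?_
    rw [Complex.exp_add]
    congr 1
    rw [show (2 * π * (-Complex.I / 2) * k : ℂ) = ((-k : ℤ) : ℂ) * (π * Complex.I) by
      push_cast; ring, Complex.exp_int_mul, Complex.exp_pi_mul_I, zpow_neg, ← inv_zpow]
    norm_num
  · congr 1
    refine tsum_congr fun k => ?_
    rw [show Complex.I * (-Complex.I / 2) = 1 / 2 by linear_combination (-1 / 2) * Complex.I_sq,
      div_eq_mul_inv (-(π : ℂ))]

theorem circleTheta_half_pos {s : ℝ} (hs : 0 < s) : 0 < circleTheta s (1 / 2) := by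
  rw [circleTheta_half_eq_inv hs]
  have := shiftedTheta_pos (inv_pos.mpr hs)
  positivity

/-- The square of a sum over `ℤ`, split according to whether the two indices have equal parity. -/
theorem sq_tsum_int_eq_tsum_add_tsum {g : ℤ → ℝ} (hg : Summable fun k => ‖g k‖) :
    (∑' k, g k) ^ 2 = ∑' p : ℤ × ℤ, g (p.1 + p.2) * g (p.1 - p.2) +
      ∑' p : ℤ × ℤ, g (p.1 + p.2 + 1) * g (p.1 - p.2) := by
  have hs := summable_mul_of_summable_norm hg hg
  set f : ℤ × ℤ → ℝ := fun p => g p.1 * g p.2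
  set u : ℤ × ℤ → ℤ × ℤ := fun p => (p.1 + p.2, p.1 - p.2) with hu
  set v : ℤ × ℤ → ℤ × ℤ := fun p => (p.1 + p.2 + 1, p.1 - p.2) with hv
  have hui : u.Injective := fun p p' h => by
    simp only [hu, Prod.mk.injEq] at h
    exact Prod.ext (by omega) (by omega)
  have hvi : v.Injective := fun p p' h => by
    simp only [hv, Prod.mk.injEq] at h
    exact Prod.ext (by omega) (by omega)
  have hc : IsCompl (Set.range u) (Set.range v) := by
    refine ⟨Set.disjoint_left.mpr ?_, codisjoint_iff.mpr ?_⟩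
    · rintro _ ⟨p, rfl⟩ ⟨p', h⟩
      simp only [hu, hv, Prod.mk.injEq] at h
      omega
    · refine Set.eq_univ_of_forall fun ⟨m, n⟩ => ?_
      rcases Int.even_or_odd' (m + n) with ⟨c, h | h⟩
      · exact Or.inl ⟨(c, m - c), Prod.ext (by simp [hu]) (by simp only [hu]; omega)⟩
      · exact Or.inr ⟨(c, m - c - 1),
          Prod.ext (by simp only [hv]; omega) (by simp only [hv]; omega)⟩
  rw [sq, tsum_mul_tsum_of_summable_norm hg hg]
  refine (HasSum.add_isCompl hc ?_ ?_).tsum_eq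
  · exact hui.hasSum_range_iff.mpr (hs.comp_injective hui).hasSum
  · exact hvi.hasSum_range_iff.mpr (hs.comp_injective hvi).hasSum

/-- The first of the duplication formulas: doubling `s` squares the nome. -/
theorem circleTheta_zero_sq {s : ℝ} (hs : 0 < s) :
    circleTheta s 0 ^ 2 = circleTheta (2 * s) 0 ^ 2 + shiftedTheta (2 * s) ^ 2 := by
  have h2 : 0 < 2 * s := by positivity
  have h3 := summable_exp_neg_mul_int_sq_norm h2
  have h4 := (summable_exp_neg_mul_int_add_half_sq h2).norm
  rw [circleTheta_zero, circleTheta_zero, shiftedTheta,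
    sq_tsum_int_eq_tsum_add_tsum (summable_exp_neg_mul_int_sq_norm hs), sq, sq,
    tsum_mul_tsum_of_summable_norm h3 h3, tsum_mul_tsum_of_summable_norm h4 h4]
  congr 1 <;> refine tsum_congr fun p => ?_ <;> rw [← exp_add, ← exp_add] <;> push_cast <;> ring_nf

theorem circleTheta_half_sq {s : ℝ} (hs : 0 < s) :
    circleTheta s (1 / 2) ^ 2 = circleTheta (2 * s) 0 ^ 2 - shiftedTheta (2 * s) ^ 2 := by
  have h2 : 0 < 2 * s := by positivity
  have h3 := summable_exp_neg_mul_int_sq_norm h2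
  have h4 := (summable_exp_neg_mul_int_add_half_sq h2).norm
  have h1 : Summable fun k : ℤ => ‖rexp (-π * s * (k : ℝ) ^ 2) * (-1) ^ k‖ := by
    simpa using summable_exp_neg_mul_int_sq hs
  rw [circleTheta_zero, circleTheta_half, shiftedTheta, sq_tsum_int_eq_tsum_add_tsum h1, sq, sq,
    tsum_mul_tsum_of_summable_norm h3 h3, tsum_mul_tsum_of_summable_norm h4 h4, sub_eq_add_neg,
    ← tsum_neg]
  have hsign (a b : ℤ) : (-1 : ℝ) ^ (a + b) * (-1) ^ (a - b) = 1 := by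
    rw [← zpow_add₀ (by norm_num)]
    exact Even.neg_one_zpow ⟨a, by ring⟩
  have hsign' (a b : ℤ) : (-1 : ℝ) ^ (a + b + 1) * (-1) ^ (a - b) = -1 := by
    rw [← zpow_add₀ (by norm_num)]
    exact Odd.neg_one_zpow ⟨a, by ring⟩
  congr 1 <;> refine tsum_congr fun p => ?_
  · rw [mul_mul_mul_comm, hsign, mul_one, ← exp_add, ← exp_add]
    push_cast
    ring_nf
  · rw [mul_mul_mul_comm, hsign', mul_neg_one, ← exp_add, ← exp_add]
    push_cast
    ring_nf

theorem shiftedTheta_sq {s : ℝ} (hs : 0 < s) :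
    shiftedTheta s ^ 2 = 2 * circleTheta (2 * s) 0 * shiftedTheta (2 * s) := by
  have h2 : 0 < 2 * s := by positivity
  have h3 := summable_exp_neg_mul_int_sq_norm h2
  have h4 := (summable_exp_neg_mul_int_add_half_sq h2).norm
  have h5 := h3.comp_injective (add_left_injective (1 : ℤ))
  have h6 : ∑' k : ℤ, rexp (-π * (2 * s) * (k : ℝ) ^ 2) =
      ∑' k : ℤ, rexp (-π * (2 * s) * ((k + 1 : ℤ) : ℝ) ^ 2) :=
    ((Equiv.addRight (1 : ℤ)).tsum_eq fun k : ℤ => rexp (-π * (2 * s) * (k : ℝ) ^ 2)).symm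
  rw [mul_assoc, two_mul]
  nth_rw 2 [circleTheta_zero]
  rw [h6, circleTheta_zero, mul_comm (∑' _, _), shiftedTheta, shiftedTheta,
    sq_tsum_int_eq_tsum_add_tsum (summable_exp_neg_mul_int_add_half_sq hs).norm,
    tsum_mul_tsum_of_summable_norm h4 h3, tsum_mul_tsum_of_summable_norm h5 h4]
  congr 1 <;> refine tsum_congr fun p => ?_ <;> simp <;> rw [← exp_add, ← exp_add] <;> ring_nf

/-- **Jacobi's identity** `θ₃⁴ = θ₂⁴ + θ₄⁴`. -/
theorem circleTheta_zero_pow_four {s : ℝ} (hs : 0 < s) :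
    circleTheta s 0 ^ 4 = shiftedTheta s ^ 4 + circleTheta s (1 / 2) ^ 4 := by
  have h1 := circleTheta_zero_sq hs
  have h2 := circleTheta_half_sq hs
  have h3 := shiftedTheta_sq hs
  rw [show circleTheta s 0 ^ 4 = (circleTheta s 0 ^ 2) ^ 2 by ring,
    show shiftedTheta s ^ 4 = (shiftedTheta s ^ 2) ^ 2 by ring,
    show circleTheta s (1 / 2) ^ 4 = (circleTheta s (1 / 2) ^ 2) ^ 2 by ring, h1, h2, h3]
  ring

theorem tendsto_circleTheta_zero :
    Filter.Tendsto (fun s => circleTheta s 0) Filter.atTop (nhds 1) := by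
  have h := tendsto_tsum_of_dominated_convergence (𝓕 := Filter.atTop)
    (f := fun (s : ℝ) (k : ℤ) => rexp (-π * s * (k : ℝ) ^ 2)) (g := fun k => if k = 0 then 1 else 0)
    (summable_exp_neg_mul_int_sq one_pos) (fun k => ?_) ?_
  · simpa only [circleTheta_zero, tsum_ite_eq] using h
  · split_ifs with hk
    · simp [hk]
    · refine tendsto_exp_atBot.comp ?_
      have hk' : 0 < π * (k : ℝ) ^ 2 := by positivity
      have := (Filter.tendsto_id.const_mul_atTop hk')
      refine (Filter.tendsto_neg_atTop_atBot.comp this).congr fun s => ?_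
      simp only [Function.comp, id]
      ring
  · filter_upwards [Filter.eventually_ge_atTop 1] with s hs k
    rw [norm_of_nonneg (exp_pos _).le, exp_le_exp]
    nlinarith [mul_nonneg (mul_nonneg pi_pos.le (sub_nonneg.mpr hs)) (sq_nonneg (k : ℝ))]

theorem shiftedTheta_lt_circleTheta_zero {s : ℝ} (hs : 0 < s) :
    shiftedTheta s < circleTheta s 0 := by
  have h := circleTheta_zero_pow_four hs
  have := pow_pos (circleTheta_half_pos hs) 4
  exact lt_of_pow_lt_pow_left₀ 4 (circleTheta_zero_pos hs).le (by linarith)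

theorem ellipticModulus_exp_nonneg (s : ℝ) : 0 ≤ RectTorus.ellipticModulus (rexp (-π * s)) := by
  rw [ellipticModulus_exp]
  positivity

theorem ellipticModulus_exp_lt_one {s : ℝ} (hs : 0 < s) :
    RectTorus.ellipticModulus (rexp (-π * s)) < 1 := by
  have h0 := circleTheta_zero_pos hs
  rw [ellipticModulus_exp, div_lt_one (by positivity)]
  exact pow_lt_pow_left₀ (shiftedTheta_lt_circleTheta_zero hs) (shiftedTheta_pos hs).le two_ne_zero

/-- Squaring the nome changes the modulus by Landen's transformation. -/
theorem ellipticModulus_exp_sq {s : ℝ} (hs : 0 < s) :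
    RectTorus.ellipticModulus (rexp (-π * s)) ^ 2 =
      4 * RectTorus.ellipticModulus (rexp (-π * (2 * s))) /
        (1 + RectTorus.ellipticModulus (rexp (-π * (2 * s)))) ^ 2 := by
  have h0 := circleTheta_zero_pos (s := 2 * s) (by positivity)
  have h2 := shiftedTheta_pos (s := 2 * s) (by positivity)
  rw [ellipticModulus_exp, ellipticModulus_exp, shiftedTheta_sq hs, circleTheta_zero_sq hs]
  have : circleTheta (2 * s) 0 ^ 2 + shiftedTheta (2 * s) ^ 2 ≠ 0 := by positivity
  field_simp
  ring

theorem circleTheta_zero_sq_eq_mul {s : ℝ} (hs : 0 < s) :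
    circleTheta s 0 ^ 2 =
      (1 + RectTorus.ellipticModulus (rexp (-π * (2 * s)))) * circleTheta (2 * s) 0 ^ 2 := by
  have h0 := circleTheta_zero_pos (s := 2 * s) (by positivity)
  rw [ellipticModulus_exp, circleTheta_zero_sq hs]
  field_simp

theorem ellipticModulus_exp_two_mul_le {s : ℝ} (hs : 0 < s) :
    RectTorus.ellipticModulus (rexp (-π * (2 * s))) ≤
      RectTorus.ellipticModulus (rexp (-π * s)) ^ 2 := by
  have h0 := ellipticModulus_exp_nonneg (2 * s)
  have h1 := ellipticModulus_exp_lt_one (s := 2 * s) (by positivity)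
  rw [ellipticModulus_exp_sq hs, le_div_iff₀ (by positivity)]
  have : (1 + RectTorus.ellipticModulus (rexp (-π * (2 * s)))) ^ 2 ≤ 4 := by nlinarith
  nlinarith

theorem ellipticModulus_exp_two_pow_le {s : ℝ} (hs : 0 < s) (n : ℕ) :
    RectTorus.ellipticModulus (rexp (-π * (2 ^ n * s))) ≤
      RectTorus.ellipticModulus (rexp (-π * s)) ^ (2 ^ n) := by
  induction n with
  | zero => simp
  | succ n ih =>
    have h := ellipticModulus_exp_two_mul_le (s := 2 ^ n * s) (by positivity)
    rw [show (2 : ℝ) ^ (n + 1) * s = 2 * (2 ^ n * s) by ring, pow_succ (2 : ℕ), pow_mul]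
    exact h.trans (pow_le_pow_left₀ (ellipticModulus_exp_nonneg _) ih 2)

/-- Jacobi's formula `θ₃² = ₂F₁(1/2, 1/2; 1; k²)`. By Landen's transformation the quotient of the
two sides does not change when the nome is squared, and it tends to `1` as the nome tends to `0`.
-/
theorem ordinaryHypergeometric_ellipticModulus_sq {s : ℝ} (hs : 0 < s) :
    ₂F₁ (1 / 2 : ℝ) (1 / 2 : ℝ) (1 : ℝ) (RectTorus.ellipticModulus (rexp (-π * s)) ^ 2) =
      circleTheta s 0 ^ 2 := by
  set F : ℝ → ℝ := ₂F₁ (1 / 2 : ℝ) (1 / 2 : ℝ) (1 : ℝ)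
  set m : ℝ → ℝ := fun s => RectTorus.ellipticModulus (rexp (-π * s)) with hm
  have hinv (t : ℝ) (ht : 0 < t) :
      F (m t ^ 2) / circleTheta t 0 ^ 2 = F (m (2 * t) ^ 2) / circleTheta (2 * t) 0 ^ 2 := by
    have h0 : 0 ≤ m (2 * t) := ellipticModulus_exp_nonneg _
    have h1 : F (m t ^ 2) = (1 + m (2 * t)) * F (m (2 * t) ^ 2) := by
      rw [← ordinaryHypergeometric_landen h0 (ellipticModulus_exp_lt_one (by positivity)),
        ← ellipticModulus_exp_sq ht]
    rw [h1, circleTheta_zero_sq_eq_mul ht, mul_div_mul_left _ _ (by positivity)]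
  have hiter (n : ℕ) : F (m (2 ^ n * s) ^ 2) / circleTheta (2 ^ n * s) 0 ^ 2 =
      F (m s ^ 2) / circleTheta s 0 ^ 2 := by
    induction n with
    | zero => simp
    | succ n ih => rw [← ih, hinv _ (by positivity : 0 < 2 ^ n * s), pow_succ' (2 : ℝ), mul_assoc]
  have hpow : Filter.Tendsto (fun n : ℕ => (2 : ℝ) ^ n * s) Filter.atTop Filter.atTop :=
    (tendsto_pow_atTop_atTop_of_one_lt one_lt_two).atTop_mul_const hs
  have hmod : Filter.Tendsto (fun n : ℕ => m (2 ^ n * s)) Filter.atTop (nhds 0) :=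
    squeeze_zero (fun n => ellipticModulus_exp_nonneg _) (ellipticModulus_exp_two_pow_le hs)
      ((tendsto_pow_atTop_nhds_zero_of_lt_one (ellipticModulus_exp_nonneg _)
        (ellipticModulus_exp_lt_one hs)).comp (tendsto_pow_atTop_atTop_of_one_lt one_lt_two))
  have hlim := (tendsto_ordinaryHypergeometric_zero.comp
    (by simpa using hmod.pow 2 : Filter.Tendsto (fun n : ℕ => m (2 ^ n * s) ^ 2) Filter.atTop
      (nhds 0))).div ((tendsto_circleTheta_zero.comp hpow).pow 2) (by norm_num)
  have hconst := tendsto_nhds_unique (tendsto_const_nhds.congr fun n => (hiter n).symm) hlim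
  have h0 := circleTheta_zero_pos hs
  rwa [one_pow, div_one, div_eq_one_iff_eq (by positivity)] at hconst

/-- The complementary modulus is `θ₄² / θ₃²`, hence the modulus for the parameter `1 / s`. -/
theorem complementaryModulus_exp {s : ℝ} (hs : 0 < s) :
    RectTorus.complementaryModulus (rexp (-π * s)) =
      RectTorus.ellipticModulus (rexp (-π * s⁻¹)) := by
  have h0 := circleTheta_zero_pos hs
  have h0' := circleTheta_zero_pos (inv_pos.mpr hs)
  have h4 := circleTheta_half_pos hs
  have h1 : 1 - (shiftedTheta s ^ 2 / circleTheta s 0 ^ 2) ^ 2 =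
      (circleTheta s (1 / 2) ^ 2 / circleTheta s 0 ^ 2) ^ 2 := by
    have := circleTheta_zero_pow_four hs
    field_simp
    linear_combination this
  rw [RectTorus.complementaryModulus, ellipticModulus_exp, h1, sqrt_sq (by positivity),
    ellipticModulus_exp, circleTheta_half_eq_inv hs, circleTheta_zero_eq_inv hs, mul_pow, mul_pow,
    mul_div_mul_left _ _ (by positivity)]

/-- In the product over `s` and `1 / s` the automorphy factors of `θ₂` and `θ₄` cancel. -/
theorem shiftedTheta_mul_shiftedTheta_inv {s : ℝ} (hs : 0 < s) :
    shiftedTheta s * shiftedTheta s⁻¹ = circleTheta s (1 / 2) * circleTheta s⁻¹ (1 / 2) := by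
  rw [circleTheta_half_eq_inv hs, circleTheta_half_eq_inv (inv_pos.mpr hs), inv_inv, sqrt_inv]
  have : √s ≠ 0 := by positivity
  field_simp

/-! ### The triple product and the extrema of the theta function -/

/-- The quotient of Gaussian binomial coefficients `[2N, N + k] / [2N, N]` with base `p`. For `k >
N` it vanishes, because the truncated subtraction `N - j` is `0` at `j = N`. -/
noncomputable def gaussBinomRatio (p : ℝ) (N k : ℕ) : ℝ :=
  ∏ j ∈ Finset.range k, (1 - p ^ (N - j)) / (1 - p ^ (N + 1 + j))

theorem gaussBinomRatio_succ (p : ℝ) (N k : ℕ) : gaussBinomRatio p N (k + 1) =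
    gaussBinomRatio p N k * ((1 - p ^ (N - k)) / (1 - p ^ (N + 1 + k))) :=
  Finset.prod_range_succ _ _

theorem gaussBinomRatio_eq_zero (p : ℝ) {N k : ℕ} (h : N < k) : gaussBinomRatio p N k = 0 :=
  Finset.prod_eq_zero (Finset.mem_range.mpr h) (by simp)

theorem gaussBinomRatio_nonneg {p : ℝ} (hp : 0 < p) (hp1 : p < 1) (N k : ℕ) :
    0 ≤ gaussBinomRatio p N k :=
  Finset.prod_nonneg fun _ _ => div_nonneg (sub_nonneg.mpr (pow_le_one₀ hp.le hp1.le))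
    (sub_nonneg.mpr (pow_le_one₀ hp.le hp1.le))

theorem gaussBinomRatio_le_one {p : ℝ} (hp : 0 < p) (hp1 : p < 1) (N k : ℕ) :
    gaussBinomRatio p N k ≤ 1 := by
  refine Finset.prod_le_one (fun _ _ => div_nonneg (sub_nonneg.mpr (pow_le_one₀ hp.le hp1.le))
    (sub_nonneg.mpr (pow_le_one₀ hp.le hp1.le))) fun j _ => ?_
  refine div_le_one_of_le₀ ?_ (sub_nonneg.mpr (pow_le_one₀ hp.le hp1.le))
  exact sub_le_sub_left (pow_le_pow_of_le_one hp.le hp1.le (by omega)) 1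

theorem tendsto_gaussBinomRatio {p : ℝ} (hp : 0 < p) (hp1 : p < 1) (k : ℕ) :
    Filter.Tendsto (fun N => gaussBinomRatio p N k) Filter.atTop (nhds 1) := by
  have h := tendsto_pow_atTop_nhds_zero_of_lt_one hp.le hp1
  have h1 (j : ℕ) : Filter.Tendsto (fun N => (1 - p ^ (N - j)) / (1 - p ^ (N + 1 + j)))
      Filter.atTop (nhds 1) := by
    have h2 := (h.comp (Filter.tendsto_sub_atTop_nat j)).const_sub 1
    have h3 := (h.comp (Filter.tendsto_add_atTop_nat (1 + j))).const_sub 1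
    rw [sub_zero] at h2 h3
    simpa only [Function.comp_apply, Pi.div_apply, add_assoc, div_one] using! h2.div h3 one_ne_zero
  have h2 := tendsto_finsetProd (Finset.range k) fun j _ => h1 j
  rwa [Finset.prod_const_one] at h2

theorem gaussBinomRatio_succ_succ {p : ℝ} (hp : 0 < p) (hp1 : p < 1) (N k : ℕ) :
    gaussBinomRatio p (N + 1) (k + 1) = gaussBinomRatio p N k *
      ((1 - p ^ (N + 1)) ^ 2 / ((1 - p ^ (N + 1 + k)) * (1 - p ^ (N + 2 + k)))) := by
  have hne (m : ℕ) : 1 - p ^ (m + 1) ≠ 0 :=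
    (sub_pos.mpr (pow_lt_one₀ hp.le hp1 m.succ_ne_zero)).ne'
  induction k with
  | zero =>
    have h1 := hne N
    have h2 := hne (N + 1)
    simp [gaussBinomRatio]
    field_simp
  | succ k ih =>
    have h1 : 1 - p ^ (N + 1 + k) ≠ 0 := by rw [add_right_comm]; exact hne _
    have h2 : 1 - p ^ (N + 2 + k) ≠ 0 := by rw [add_right_comm]; exact hne _
    have h3 : 1 - p ^ (N + 3 + k) ≠ 0 := by rw [add_right_comm]; exact hne _
    rw [gaussBinomRatio_succ, ih, gaussBinomRatio_succ, Nat.add_sub_add_right,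
      show N + 1 + 1 + (k + 1) = N + 3 + k by ring, show N + 1 + (k + 1) = N + 2 + k by ring]
    field_simp

/-- The quotient `[2N + 2, N + 1] / [2N, N]` of central Gaussian binomial coefficients with base
`Q²`. -/
noncomputable def centralGaussBinomStep (Q : ℝ) (N : ℕ) : ℝ :=
  (1 - Q ^ (4 * N + 2)) * (1 - Q ^ (4 * N + 4)) / (1 - Q ^ (2 * N + 2)) ^ 2

theorem centralGaussBinomStep_pos {Q : ℝ} (hQ : 0 < Q) (hQ1 : Q < 1) (N : ℕ) :
    0 < centralGaussBinomStep Q N := by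
  have h (m : ℕ) : 0 < 1 - Q ^ (m + 1) := sub_pos.mpr (pow_lt_one₀ hQ.le hQ1 m.succ_ne_zero)
  exact div_pos (mul_pos (h _) (h _)) (pow_pos (h _) 2)

/-- The coefficient of `w ^ k` and of `w ^ (-k)` in the product of the factors `(1 + Q ^ (2n + 1)
w) (1 + Q ^ (2n + 1) w⁻¹)` over `n < N`, divided by the coefficient of `w ^ 0`. -/
noncomputable def tripleProductCoeff (Q : ℝ) (N k : ℕ) : ℝ :=
  gaussBinomRatio (Q ^ 2) N k * Q ^ (k ^ 2)

theorem tripleProductCoeff_rec_zero {Q : ℝ} (hQ : 0 < Q) (hQ1 : Q < 1) (N : ℕ) :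
    (1 + Q ^ (4 * N + 2)) * tripleProductCoeff Q N 0 +
      Q ^ (2 * N + 1) * (tripleProductCoeff Q N 1 + tripleProductCoeff Q N 1) =
    centralGaussBinomStep Q N * tripleProductCoeff Q (N + 1) 0 := by
  have hne : 1 - Q ^ (2 * N + 2) ≠ 0 := (sub_pos.mpr (pow_lt_one₀ hQ.le hQ1 (by omega))).ne'
  have hp : (Q ^ 2) ^ (N + 1) = Q ^ (2 * N + 2) := by rw [← pow_mul]; ring_nf
  have hp' : (Q ^ 2) ^ N = Q ^ (2 * N) := by rw [← pow_mul]
  simp only [tripleProductCoeff, gaussBinomRatio, centralGaussBinomStep, Finset.prod_range_zero,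
    Finset.prod_range_one, Nat.sub_zero, add_zero, hp, hp']
  field_simp
  ring

theorem tripleProductCoeff_rec_succ {Q : ℝ} (hQ : 0 < Q) (hQ1 : Q < 1) (N k : ℕ) :
    (1 + Q ^ (4 * N + 2)) * tripleProductCoeff Q N (k + 1) +
      Q ^ (2 * N + 1) * (tripleProductCoeff Q N k + tripleProductCoeff Q N (k + 2)) =
    centralGaussBinomStep Q N * tripleProductCoeff Q (N + 1) (k + 1) := by
  have hne (m : ℕ) : 1 - Q ^ (m + 1) ≠ 0 :=
    (sub_pos.mpr (pow_lt_one₀ hQ.le hQ1 m.succ_ne_zero)).ne'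
  have hp : 0 < Q ^ 2 := by positivity
  have hp1 : Q ^ 2 < 1 := pow_lt_one₀ hQ.le hQ1 two_ne_zero
  rcases lt_trichotomy k N with h | rfl | h
  · obtain ⟨d, rfl⟩ := Nat.exists_eq_add_of_lt h
    have h1 := hne (4 * k + 2 * d + 3)
    have h2 := hne (4 * k + 2 * d + 5)
    have h3 := hne (2 * k + 2 * d + 3)
    simp only [tripleProductCoeff, centralGaussBinomStep]
    rw [gaussBinomRatio_succ_succ hp hp1 (k + d + 1) k, gaussBinomRatio_succ _ _ (k + 1),
      gaussBinomRatio_succ]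
    simp only [← pow_mul]
    rw [show k + d + 1 - k = d + 1 by omega, show k + d + 1 - (k + 1) = d by omega,
      show 2 * (k + d + 1 + 1 + k) = 4 * k + 2 * d + 3 + 1 by ring,
      show 2 * (k + d + 1 + 2 + k) = 4 * k + 2 * d + 5 + 1 by ring,
      show 2 * (k + d + 1 + 1 + (k + 1)) = 4 * k + 2 * d + 5 + 1 by ring,
      show 2 * (k + d + 1 + 1) = 2 * k + 2 * d + 3 + 1 by ring,
      show 2 * (k + d + 1) + 2 = 2 * k + 2 * d + 3 + 1 by ring]
    field_simp
    ring
  · have h1 := hne (4 * k + 1)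
    have h2 := hne (4 * k + 3)
    have h3 := hne (2 * k + 1)
    simp only [tripleProductCoeff, gaussBinomRatio_succ_succ hp hp1,
      gaussBinomRatio_eq_zero _ (Nat.lt_succ_self k),
      gaussBinomRatio_eq_zero _ (show k < k + 2 by omega), centralGaussBinomStep, ← pow_mul]
    rw [show 2 * (k + 1 + k) = 4 * k + 1 + 1 by ring,
      show 2 * (k + 2 + k) = 4 * k + 3 + 1 by ring, show 2 * (k + 1) = 2 * k + 1 + 1 by ring]
    field_simp
    ring
  · simp only [tripleProductCoeff, gaussBinomRatio_eq_zero _ h,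
      gaussBinomRatio_eq_zero _ (show N < k + 1 by omega),
      gaussBinomRatio_eq_zero _ (show N < k + 2 by omega),
      gaussBinomRatio_eq_zero _ (show N + 1 < k + 1 by omega)]
    ring

/-- Comparison of coefficients when the product is multiplied by its next factor
`1 + Q ^ (4N + 2) + Q ^ (2N + 1) (w + w⁻¹)`. -/
theorem tripleProductCoeff_rec {Q : ℝ} (hQ : 0 < Q) (hQ1 : Q < 1) (N : ℕ) (k : ℤ) :
    (1 + Q ^ (4 * N + 2)) * tripleProductCoeff Q N k.natAbs +
      Q ^ (2 * N + 1) * (tripleProductCoeff Q N (k - 1).natAbs +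
        tripleProductCoeff Q N (k + 1).natAbs) =
    centralGaussBinomStep Q N * tripleProductCoeff Q (N + 1) k.natAbs := by
  rcases lt_trichotomy k 0 with h | rfl | h
  · obtain ⟨m, rfl⟩ : ∃ m : ℕ, k = -((m : ℤ) + 1) := ⟨(-k - 1).toNat, by omega⟩
    rw [show (-((m : ℤ) + 1)).natAbs = m + 1 by omega,
      show (-((m : ℤ) + 1) - 1).natAbs = m + 2 by omega,
      show (-((m : ℤ) + 1) + 1).natAbs = m by omega, add_comm (tripleProductCoeff Q N (m + 2))]
    exact tripleProductCoeff_rec_succ hQ hQ1 N m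
  · exact tripleProductCoeff_rec_zero hQ hQ1 N
  · obtain ⟨m, rfl⟩ : ∃ m : ℕ, k = (m : ℤ) + 1 := ⟨(k - 1).toNat, by omega⟩
    rw [show ((m : ℤ) + 1).natAbs = m + 1 by omega,
      show ((m : ℤ) + 1 - 1).natAbs = m by omega, show ((m : ℤ) + 1 + 1).natAbs = m + 2 by omega]
    exact tripleProductCoeff_rec_succ hQ hQ1 N m

theorem norm_tripleProductCoeff_mul_cos_le {Q : ℝ} (hQ : 0 < Q) (hQ1 : Q < 1) (N k : ℕ) (x : ℝ) :
    ‖tripleProductCoeff Q N k * cos x‖ ≤ Q ^ (k ^ 2) := by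
  have hp : 0 < Q ^ 2 := by positivity
  have hp1 : Q ^ 2 < 1 := pow_lt_one₀ hQ.le hQ1 two_ne_zero
  rw [norm_mul, tripleProductCoeff, norm_mul, norm_of_nonneg (gaussBinomRatio_nonneg hp hp1 N k),
    norm_of_nonneg (by positivity : 0 ≤ Q ^ (k ^ 2)), mul_assoc, mul_comm]
  calc Q ^ (k ^ 2) * ‖cos x‖ * gaussBinomRatio (Q ^ 2) N k ≤ Q ^ (k ^ 2) * 1 * 1 := by
        have h0 := gaussBinomRatio_nonneg hp hp1 N k
        gcongr
        · exact abs_cos_le_one x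
        · exact gaussBinomRatio_le_one hp hp1 N k
    _ = _ := by ring

theorem exp_neg_pi_mul_pow_natAbs_sq (s : ℝ) (k : ℤ) :
    rexp (-π * s) ^ (k.natAbs ^ 2) = rexp (-π * s * (k : ℝ) ^ 2) := by
  rw [← exp_nat_mul]
  push_cast
  rw [Nat.cast_natAbs, Int.cast_abs, sq_abs, mul_comm]

/-- A finite form of the **Jacobi triple product**: up to a positive constant, the product is a
trigonometric polynomial with explicit coefficients. -/
theorem exists_prod_eq_mul_tsum_tripleProductCoeff {s : ℝ} (hs : 0 < s) (N : ℕ) :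
    ∃ b : ℝ, 0 < b ∧ ∀ θ : ℝ,
      ∏ n ∈ Finset.range N, (1 + rexp (-π * s) ^ (4 * n + 2) +
          2 * rexp (-π * s) ^ (2 * n + 1) * cos θ) =
        b * ∑' k : ℤ, tripleProductCoeff (rexp (-π * s)) N k.natAbs * cos (k * θ) := by
  have hQ : 0 < rexp (-π * s) := exp_pos _
  have hQ1 : rexp (-π * s) < 1 := exp_lt_one_iff.mpr (by nlinarith [mul_pos pi_pos hs])
  set Q := rexp (-π * s) with hQdef
  have hsum (N : ℕ) (f : ℤ → ℝ) :
      Summable fun k : ℤ => tripleProductCoeff Q N k.natAbs * cos (f k) :=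
    Summable.of_norm_bounded (summable_exp_neg_mul_int_sq hs) fun k => by
      rw [← exp_neg_pi_mul_pow_natAbs_sq]
      exact norm_tripleProductCoeff_mul_cos_le hQ hQ1 N _ _
  induction N with
  | zero =>
    refine ⟨1, one_pos, fun θ => ?_⟩
    rw [tsum_eq_single 0]
    · simp [tripleProductCoeff, gaussBinomRatio]
    · intro k hk
      rw [tripleProductCoeff, gaussBinomRatio_eq_zero _ (Int.natAbs_pos.mpr hk), zero_mul, zero_mul]
  | succ N ih =>
    obtain ⟨b, hb, h⟩ := ih
    refine ⟨b * centralGaussBinomStep Q N, mul_pos hb (centralGaussBinomStep_pos hQ hQ1 N),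
      fun θ => ?_⟩
    have hS := (hsum N fun k => k * θ).hasSum
    have hdown := (hsum N fun k => (k + 1 : ℤ) * θ).hasSum
    have hup := (hsum N fun k => (k - 1 : ℤ) * θ).hasSum
    -- Multiplication by `2 cos θ` adds the two shifts of the coefficient sequence.
    have hcos : 2 * cos θ * ∑' k : ℤ, tripleProductCoeff Q N k.natAbs * cos (k * θ) =
        (∑' k : ℤ, tripleProductCoeff Q N k.natAbs * cos ((k + 1 : ℤ) * θ)) +
        ∑' k : ℤ, tripleProductCoeff Q N k.natAbs * cos ((k - 1 : ℤ) * θ) := by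
      rw [← tsum_mul_left, ← hdown.summable.tsum_add hup.summable]
      refine tsum_congr fun k => ?_
      push_cast
      rw [add_mul, sub_mul, one_mul, cos_add, cos_sub]
      ring
    rw [← (Equiv.subRight (1 : ℤ)).hasSum_iff] at hdown
    rw [← (Equiv.addRight (1 : ℤ)).hasSum_iff] at hup
    have hall := (hS.mul_left (1 + Q ^ (4 * N + 2))).add
      ((hdown.add hup).mul_left (Q ^ (2 * N + 1)))
    rw [← hcos] at hall
    have hcoeff (k : ℤ) : (1 + Q ^ (4 * N + 2)) * (tripleProductCoeff Q N k.natAbs * cos (k * θ)) +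
        Q ^ (2 * N + 1) * (tripleProductCoeff Q N (k - 1).natAbs * cos ((k - 1 + 1 : ℤ) * θ) +
          tripleProductCoeff Q N (k + 1).natAbs * cos ((k + 1 - 1 : ℤ) * θ)) =
        centralGaussBinomStep Q N * (tripleProductCoeff Q (N + 1) k.natAbs * cos (k * θ)) := by
      rw [sub_add_cancel, add_sub_cancel_right, ← mul_assoc (centralGaussBinomStep Q N),
        ← tripleProductCoeff_rec hQ hQ1]
      ring
    have hall' := hall.tsum_eq.symm.trans (tsum_congr hcoeff)
    rw [tsum_mul_left] at hall'
    rw [Finset.prod_range_succ, h, mul_assoc b (centralGaussBinomStep Q N), ← hall']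
    ring

theorem tendsto_tsum_tripleProductCoeff {s : ℝ} (hs : 0 < s) (x : ℝ) :
    Filter.Tendsto
      (fun N => ∑' k : ℤ, tripleProductCoeff (rexp (-π * s)) N k.natAbs * cos (k * (2 * π * x)))
      Filter.atTop (nhds (circleTheta s x)) := by
  have hQ : 0 < rexp (-π * s) := exp_pos _
  have hQ1 : rexp (-π * s) < 1 := exp_lt_one_iff.mpr (by nlinarith [mul_pos pi_pos hs])
  refine tendsto_tsum_of_dominated_convergence (summable_exp_neg_mul_int_sq hs) (fun k => ?_)
    (Filter.Eventually.of_forall fun N k => ?_)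
  · have h := ((tendsto_gaussBinomRatio (pow_pos hQ 2) (pow_lt_one₀ hQ.le hQ1 two_ne_zero)
      k.natAbs).mul_const (rexp (-π * s) ^ (k.natAbs ^ 2))).mul_const (cos (k * (2 * π * x)))
    rw [one_mul, exp_neg_pi_mul_pow_natAbs_sq] at h
    simp only [tripleProductCoeff, exp_neg_pi_mul_pow_natAbs_sq]
    rwa [show 2 * π * k * x = k * (2 * π * x) by ring]
  · rw [← exp_neg_pi_mul_pow_natAbs_sq]
    exact norm_tripleProductCoeff_mul_cos_le hQ hQ1 N _ _

/-- The temperature on the circle is lowest at the antipode of the source: each factor of the triple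
product is nonnegative and smallest there. -/
theorem circleTheta_half_le {s : ℝ} (hs : 0 < s) (x : ℝ) :
    circleTheta s (1 / 2) ≤ circleTheta s x := by
  refine le_of_tendsto_of_tendsto' (tendsto_tsum_tripleProductCoeff hs (1 / 2))
    (tendsto_tsum_tripleProductCoeff hs x) fun N => ?_
  obtain ⟨b, hb, h⟩ := exists_prod_eq_mul_tsum_tripleProductCoeff hs N
  refine le_of_mul_le_mul_left ?_ hb
  rw [← h, ← h]
  set Q := rexp (-π * s)
  have hQ : 0 < Q := exp_pos _
  refine Finset.prod_le_prod (fun n _ => ?_) fun n _ => ?_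
  · rw [show 2 * π * (1 / 2) = π by ring, cos_pi]
    nlinarith [sq_nonneg (1 - Q ^ (2 * n + 1)), show Q ^ (4 * n + 2) = (Q ^ (2 * n + 1)) ^ 2 by
      rw [← pow_mul]; ring_nf]
  · rw [show 2 * π * (1 / 2) = π by ring, cos_pi]
    gcongr
    exact neg_one_le_cos _

theorem circleTheta_le_zero {s : ℝ} (hs : 0 < s) (x : ℝ) : circleTheta s x ≤ circleTheta s 0 := by
  rw [circleTheta_zero]
  have hb (k : ℤ) : ‖rexp (-π * s * (k : ℝ) ^ 2) * cos (2 * π * k * x)‖ ≤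
      rexp (-π * s * (k : ℝ) ^ 2) := by
    rw [norm_mul, norm_of_nonneg (exp_pos _).le]
    exact mul_le_of_le_one_right (exp_pos _).le (abs_cos_le_one _)
  have hs' := summable_exp_neg_mul_int_sq hs
  exact (Summable.of_norm_bounded hs' hb).tsum_le_tsum
    (fun k => (le_abs_self _).trans (hb k)) hs'

/-! ### The heat kernel of the torus -/

theorem summable_norm_exp_mul_cexp {s : ℝ} (hs : 0 < s) (u : ℝ) :
    Summable fun k : ℤ =>
      ‖(rexp (-π * s * (k : ℝ) ^ 2) : ℂ) * Complex.exp ((2 * π * k * u : ℝ) * Complex.I)‖ := by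
  simpa only [norm_mul, Complex.norm_real, Complex.norm_exp_ofReal_mul_I, mul_one] using
    summable_exp_neg_mul_int_sq_norm hs

theorem tsum_exp_mul_cexp {s : ℝ} (hs : 0 < s) (u : ℝ) :
    ∑' k : ℤ, (rexp (-π * s * (k : ℝ) ^ 2) : ℂ) * Complex.exp ((2 * π * k * u : ℝ) * Complex.I) =
      circleTheta s u := by
  have h := (summable_norm_exp_mul_cexp hs u).of_norm.hasSum
  have h' := (Equiv.neg ℤ).hasSum_iff.mpr h
  have h2 := (h.add h').tsum_eq
  rw [← two_mul] at h2
  refine mul_left_cancel₀ two_ne_zero (h2.symm.trans ?_)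
  rw [circleTheta, Complex.ofReal_tsum, ← tsum_mul_left]
  refine tsum_congr fun k => ?_
  simp only [Function.comp_apply, Equiv.neg_apply, Int.cast_neg, neg_sq, Complex.ofReal_mul]
  rw [Complex.ofReal_cos, ← mul_add, mul_left_comm, Complex.two_cos]
  push_cast
  ring_nf

/-- The heat kernel of the rectangular torus is the product of the heat kernels of its two
circles. -/
theorem temperature_one_coe {α : ℝ} (hα : 0 < α) (x y x' y' : ℝ) :
    RectTorus.temperature α 1 ((x : AddCircle α⁻¹), (y : AddCircle α))
        ((x' : AddCircle α⁻¹), (y' : AddCircle α)) =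
      circleTheta (α ^ 2) (α * (x - x')) * circleTheta (α⁻¹ ^ 2) (α⁻¹ * (y - y')) := by
  have h1 : 0 < α ^ 2 := by positivity
  have h2 : 0 < α⁻¹ ^ 2 := by positivity
  have hterm (κ : ℤ × ℤ) :
      RectTorus.heatTerm α (1 / (4 * π)) ((x : AddCircle α⁻¹), (y : AddCircle α))
      ((x' : AddCircle α⁻¹), (y' : AddCircle α)) κ =
      ((rexp (-π * α ^ 2 * (κ.1 : ℝ) ^ 2) : ℂ) *
        Complex.exp ((2 * π * κ.1 * (α * (x - x')) : ℝ) * Complex.I)) *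
      ((rexp (-π * α⁻¹ ^ 2 * (κ.2 : ℝ) ^ 2) : ℂ) *
        Complex.exp ((2 * π * κ.2 * (α⁻¹ * (y - y')) : ℝ) * Complex.I)) := by
    rw [RectTorus.heatTerm, RectTorus.eigenfunction_coe, RectTorus.eigenfunction_coe,
      ← Complex.exp_conj, ← Complex.exp_add, mul_mul_mul_comm, ← Complex.exp_add,
      ← Complex.ofReal_mul, ← Real.exp_add]
    congr 2
    · congr 1
      rw [RectTorus.eigenvalue]
      field_simp
      ring
    · simp only [map_mul, map_add, Complex.conj_ofReal, Complex.conj_I, map_ofNat,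
        map_intCast]
      push_cast
      ring
  rw [RectTorus.temperature, RectTorus.heatKernel, tsum_congr hterm,
    ← tsum_mul_tsum_of_summable_norm (summable_norm_exp_mul_cexp h1 _)
      (summable_norm_exp_mul_cexp h2 _), tsum_exp_mul_cexp h1, tsum_exp_mul_cexp h2,
    ← Complex.ofReal_mul, Complex.ofReal_re]

theorem mainTheorem1 (α : ℝ) (hα : 0 < α) (k k' : ℝ)
    (hk : k = RectTorus.ellipticModulus (rexp (-π * α ^ 2)))
    (hk' : k' = RectTorus.complementaryModulus (rexp (-π * α ^ 2))) :
    (∀ w : RectTorus.Torus α,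
      IsLeast (Set.range fun z : RectTorus.Torus α => RectTorus.temperature α 1 z w)
        (√(k * k' * ₂F₁ (1 / 2 : ℝ) (1 / 2 : ℝ) (1 : ℝ) (k ^ 2) *
          ₂F₁ (1 / 2 : ℝ) (1 / 2 : ℝ) (1 : ℝ) (k' ^ 2))) ∧
      IsGreatest (Set.range fun z : RectTorus.Torus α => RectTorus.temperature α 1 z w)
        (√(₂F₁ (1 / 2 : ℝ) (1 / 2 : ℝ) (1 : ℝ) (k ^ 2) *
          ₂F₁ (1 / 2 : ℝ) (1 / 2 : ℝ) (1 : ℝ) (k' ^ 2)))) ∧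
    k' = RectTorus.ellipticModulus (rexp (-π * α⁻¹ ^ 2)) := by
  have h1 : 0 < α ^ 2 := by positivity
  have h2 : 0 < α⁻¹ ^ 2 := by positivity
  have hmod : k' = RectTorus.ellipticModulus (rexp (-π * α⁻¹ ^ 2)) := by
    rw [hk', complementaryModulus_exp h1, inv_pow]
  have hF : ₂F₁ (1 / 2 : ℝ) (1 / 2 : ℝ) (1 : ℝ) (k ^ 2) = circleTheta (α ^ 2) 0 ^ 2 := by
    rw [hk, ordinaryHypergeometric_ellipticModulus_sq h1]
  have hF' : ₂F₁ (1 / 2 : ℝ) (1 / 2 : ℝ) (1 : ℝ) (k' ^ 2) = circleTheta (α⁻¹ ^ 2) 0 ^ 2 := by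
    rw [hmod, ordinaryHypergeometric_ellipticModulus_sq h2]
  have p1 := circleTheta_zero_pos h1
  have p2 := circleTheta_zero_pos h2
  have q1 := circleTheta_half_pos h1
  have q2 := circleTheta_half_pos h2
  have hmax : √(₂F₁ (1 / 2 : ℝ) (1 / 2 : ℝ) (1 : ℝ) (k ^ 2) *
      ₂F₁ (1 / 2 : ℝ) (1 / 2 : ℝ) (1 : ℝ) (k' ^ 2)) =
      circleTheta (α ^ 2) 0 * circleTheta (α⁻¹ ^ 2) 0 := by
    rw [hF, hF', ← mul_pow, sqrt_sq (by positivity)]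
  have hmin : √(k * k' * ₂F₁ (1 / 2 : ℝ) (1 / 2 : ℝ) (1 : ℝ) (k ^ 2) *
      ₂F₁ (1 / 2 : ℝ) (1 / 2 : ℝ) (1 : ℝ) (k' ^ 2)) =
      circleTheta (α ^ 2) (1 / 2) * circleTheta (α⁻¹ ^ 2) (1 / 2) := by
    have h := shiftedTheta_mul_shiftedTheta_inv h1
    rw [← inv_pow] at h
    have hcancel {a b c d : ℝ} (hb : b ≠ 0) (hd : d ≠ 0) :
        a ^ 2 / b ^ 2 * (c ^ 2 / d ^ 2) * b ^ 2 * d ^ 2 = (a * c) ^ 2 := by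
      field_simp
    rw [hF, hF', hk, hmod, ellipticModulus_exp, ellipticModulus_exp, hcancel p1.ne' p2.ne',
      sqrt_sq (mul_pos (shiftedTheta_pos h1) (shiftedTheta_pos h2)).le, h]
  refine ⟨fun w => ?_, hmod⟩
  obtain ⟨x, hx⟩ := QuotientAddGroup.mk_surjective w.1
  obtain ⟨y, hy⟩ := QuotientAddGroup.mk_surjective w.2
  obtain rfl : w = ((x : AddCircle α⁻¹), (y : AddCircle α)) := Prod.ext hx.symm hy.symm
  rw [hmin, hmax]
  refine ⟨⟨⟨((x + α⁻¹ / 2 : ℝ), (y + α / 2 : ℝ)), ?_⟩, ?_⟩,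
    ⟨⟨((x : AddCircle α⁻¹), (y : AddCircle α)), ?_⟩, ?_⟩⟩
  · -- The minimum is attained at the point half a period away from the source in both directions.
    dsimp only
    rw [temperature_one_coe hα, add_sub_cancel_left, add_sub_cancel_left, ← mul_div_assoc,
      ← mul_div_assoc, mul_inv_cancel₀ hα.ne', inv_mul_cancel₀ hα.ne']
  · rintro _ ⟨⟨z, z'⟩, rfl⟩
    obtain ⟨a, rfl⟩ := QuotientAddGroup.mk_surjective z
    obtain ⟨b, rfl⟩ := QuotientAddGroup.mk_surjective z'
    refine le_of_le_of_eq ?_ (temperature_one_coe hα a b x y).symm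
    exact mul_le_mul (circleTheta_half_le h1 _) (circleTheta_half_le h2 _) q2.le
      (q1.le.trans (circleTheta_half_le h1 _))
  · dsimp only
    rw [temperature_one_coe hα, sub_self, sub_self, mul_zero, mul_zero]
  · rintro _ ⟨⟨z, z'⟩, rfl⟩
    obtain ⟨a, rfl⟩ := QuotientAddGroup.mk_surjective z
    obtain ⟨b, rfl⟩ := QuotientAddGroup.mk_surjective z'
    refine le_of_eq_of_le (temperature_one_coe hα a b x y) ?_
    exact mul_le_mul (circleTheta_le_zero h1 _) (circleTheta_le_zero h2 _)
      (q2.le.trans (circleTheta_half_le h2 _)) p1.le
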